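/- Let $X\in\mathbb C^{n\times p}$ and $Y\in\mathbb C^{n\times q}$ with $q\le p$ be matrices of full rank, and let $X^HY$ also be of full rank. Let $$[X\;\;Y]=[Q\;\;Q_\perp]\begin{bmatrix}R_{11}&R_{12}\\ O&R_{22}\end{bmatrix}$$ be a QR factorization, that is, $Q\in\mathbb C^{n\times p}$ and $Q_\perp\in\mathbb C^{n\times m}$ are such that $[Q\;\;Q_\perp]$ has orthonormal columns, and $R_{11}\in\mathbb C^{p\times p}$, $R_{12}\in\mathbb C^{p\times q}$, $R_{22}\in\mathbb C^{m\times q}$ are such that the block matrix is upper triangular, i.e. its entries strictly below the main diagonal vanish. (For $m=n-p$ this is the full factorization, in which $[Q\;\;Q_\perp]$ is unitary.) Let $\mathcal R(A)$ denote the column range of a matrix $A$. The principal angles $\Theta(\mathcal X,\mathcal Y)=[\theta_1,\dots,\theta_s]$, $s=\min(\dim\mathcal X,\dim\mathcal Y)$, between subspaces $\mathcal X,\mathcal Y\subseteq\mathbb C^n$ are the numbers $\theta_k\in[0,\pi/2]$ defined recursively by $$\cos\theta_k=\max_{x\in\mathcal X}\max_{y\in\mathcal Y}|x^Hy|=|x_k^Hy_k|\quad\text{subject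 to } \|x\|=\|y\|=1,\ x_i^Hx=0,\ y_i^Hy=0,\ i=1,\dots,k-1.$$ Then all the angles in $\Theta(\mathcal R(X),\mathcal R(Y))$ are smaller than $\pi/2$, and $$\tan\Theta(\mathcal R(X),\mathcal R(Y))=\bigl[S_+(R_{22}R_{12}^\dagger),0,\dots,0\bigr]$$ with exactly $\dim(\mathcal R(X)\cap\mathcal R(Y))$ zeros, where the tangents are listed in decreasing order, $S_+(T)$ is the list, in decreasing order and with multiplicity, of the positive singular values of $T$, and $\dagger$ denotes the Moore–Penrose pseudoinverse. -/

import Mathlib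

open scoped Matrix InnerProductSpace

/-- A rectangular complex matrix is of full rank: its rank is the smaller of its two dimensions. -/
def IsFullRank {a b : ℕ} (A : Matrix (Fin a) (Fin b) ℂ) : Prop :=
  A.rank = min a b

/-- The column range of a matrix, as a subspace of the Hermitian space `ℂⁿ`. -/
noncomputable def colRange {n p : ℕ} (A : Matrix (Fin n) (Fin p) ℂ) :
    Submodule ℂ (EuclideanSpace ℂ (Fin n)) :=
  LinearMap.range (Matrix.toEuclideanLin A)

/-! ### Principal angles between subspaces -/

/-- The constraint set of the `k`-th step of the recursive definition of principal angles: pairs of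
unit vectors of `𝒳` and `𝒴` orthogonal to the previously selected `x i` and `y i`, `i < k`. -/
def principalFeasible {n m : ℕ} (𝒳 𝒴 : Submodule ℂ (EuclideanSpace ℂ (Fin n)))
    (x y : Fin m → EuclideanSpace ℂ (Fin n)) (k : Fin m) :
    Set (EuclideanSpace ℂ (Fin n) × EuclideanSpace ℂ (Fin n)) :=
  {w | w.1 ∈ 𝒳 ∧ w.2 ∈ 𝒴 ∧ ‖w.1‖ = 1 ∧ ‖w.2‖ = 1 ∧
    ∀ i < k, ⟪x i, w.1⟫_ℂ = 0 ∧ ⟪y i, w.2⟫_ℂ = 0}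

/-- `x`, `y` are principal vectors of `𝒳`, `𝒴`: for each `k`, the pair `(x k, y k)` maximizes
`|⟪u, v⟫|` over the constraint set determined by the previous pairs. -/
def IsPrincipalVectors {n m : ℕ} (𝒳 𝒴 : Submodule ℂ (EuclideanSpace ℂ (Fin n)))
    (x y : Fin m → EuclideanSpace ℂ (Fin n)) : Prop :=
  ∀ k : Fin m, (x k, y k) ∈ principalFeasible 𝒳 𝒴 x y k ∧
    ∀ w ∈ principalFeasible 𝒳 𝒴 x y k, ‖⟪w.1, w.2⟫_ℂ‖ ≤ ‖⟪x k, y k⟫_ℂ‖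

/-- `θ = [θ₁, …, θ_m]`, `m = min (dim 𝒳) (dim 𝒴)`, is the vector of principal angles between `𝒳`
and `𝒴` given by the recursive definition:
`θ_k ∈ [0, π/2]` and `cos θ_k = max |⟪x, y⟫| = |⟪x_k, y_k⟫|`. -/
def IsPrincipalAngles {n : ℕ} (𝒳 𝒴 : Submodule ℂ (EuclideanSpace ℂ (Fin n)))
    (θ : Fin (min (Module.finrank ℂ 𝒳) (Module.finrank ℂ 𝒴)) → ℝ) : Prop :=
  ∃ x y, IsPrincipalVectors 𝒳 𝒴 x y ∧
    ∀ k, θ k ∈ Set.Icc 0 (Real.pi / 2) ∧ Real.cos (θ k) = ‖⟪x k, y k⟫_ℂ‖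

theorem exists_unit_mem_orthogonal {n j : ℕ} (𝒳 : Submodule ℂ (EuclideanSpace ℂ (Fin n)))
    (hj : j < Module.finrank ℂ 𝒳) (x : Fin j → EuclideanSpace ℂ (Fin n)) :
    ∃ u ∈ 𝒳, ‖u‖ = 1 ∧ ∀ i, ⟪x i, u⟫_ℂ = 0 := by
  set K := Submodule.span ℂ (Set.range x) with hK
  have hKj : Module.finrank ℂ K ≤ j := by
    have := finrank_range_le_card (R := ℂ) x
    rwa [Fintype.card_fin] at this
  have hne : 𝒳 ⊓ Kᗮ ≠ ⊥ := by
    intro h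
    have h1 := Submodule.finrank_add_finrank_le_of_disjoint (disjoint_iff.mpr h)
    have h2 := K.finrank_add_finrank_orthogonal
    omega
  obtain ⟨v, hv, hv0⟩ := Submodule.exists_mem_ne_zero_of_ne_bot hne
  have hvn : ‖v‖ ≠ 0 := norm_ne_zero_iff.mpr hv0
  refine ⟨((‖v‖⁻¹ : ℝ) : ℂ) • v, 𝒳.smul_mem _ hv.1, ?_, fun i => ?_⟩
  · rw [norm_smul]; simp [hvn]
  · have := (Submodule.mem_orthogonal K v).mp hv.2 (x i) (Submodule.subset_span ⟨i, rfl⟩)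
    rw [inner_smul_right, this, mul_zero]

theorem exists_isPrincipalVectors {n : ℕ} (𝒳 𝒴 : Submodule ℂ (EuclideanSpace ℂ (Fin n))) (m : ℕ)
    (hm : m ≤ min (Module.finrank ℂ 𝒳) (Module.finrank ℂ 𝒴)) :
    ∃ x y : Fin m → EuclideanSpace ℂ (Fin n), IsPrincipalVectors 𝒳 𝒴 x y := by
  induction m with
  | zero => exact ⟨Fin.elim0, Fin.elim0, fun k => k.elim0⟩
  | succ j ih =>
    obtain ⟨x, y, hxy⟩ := ih (by omega)
    let S : Set (EuclideanSpace ℂ (Fin n) × EuclideanSpace ℂ (Fin n)) :=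
      {w | w.1 ∈ 𝒳 ∧ w.2 ∈ 𝒴 ∧ ‖w.1‖ = 1 ∧ ‖w.2‖ = 1 ∧
        ∀ i : Fin j, ⟪x i, w.1⟫_ℂ = 0 ∧ ⟪y i, w.2⟫_ℂ = 0}
    have hSne : S.Nonempty := by
      obtain ⟨u, h1, h2, h3⟩ := exists_unit_mem_orthogonal 𝒳 (by omega) x
      obtain ⟨v, h4, h5, h6⟩ := exists_unit_mem_orthogonal 𝒴 (by omega) y
      exact ⟨(u, v), h1, h4, h2, h5, fun i => ⟨h3 i, h6 i⟩⟩
    have hSc : IsCompact S := by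
      have hcl : IsClosed S := by
        refine IsClosed.inter (𝒳.closed_of_finiteDimensional.preimage continuous_fst) ?_
        refine IsClosed.inter (𝒴.closed_of_finiteDimensional.preimage continuous_snd) ?_
        refine IsClosed.inter (isClosed_eq (by fun_prop) (by fun_prop)) ?_
        refine IsClosed.inter (isClosed_eq (by fun_prop) (by fun_prop)) ?_
        have h : IsClosed (⋂ i : Fin j, {w : EuclideanSpace ℂ (Fin n) × EuclideanSpace ℂ (Fin n) |
            ⟪x i, w.1⟫_ℂ = 0} ∩ {w | ⟪y i, w.2⟫_ℂ = 0}) :=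
          isClosed_iInter fun i => IsClosed.inter
            (isClosed_eq (by fun_prop) (by fun_prop)) (isClosed_eq (by fun_prop) (by fun_prop))
        have h2 : {w : EuclideanSpace ℂ (Fin n) × EuclideanSpace ℂ (Fin n) |
            ∀ i : Fin j, ⟪x i, w.1⟫_ℂ = 0 ∧ ⟪y i, w.2⟫_ℂ = 0} =
            ⋂ i : Fin j, {w | ⟪x i, w.1⟫_ℂ = 0} ∩ {w | ⟪y i, w.2⟫_ℂ = 0} := by
          ext w
          simp
        rw [← h2] at h
        exact h
      refine ((isCompact_sphere 0 1).prod (isCompact_sphere 0 1)).of_isClosed_subset hcl ?_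
      rintro ⟨u, v⟩ ⟨-, -, h1, h2, -⟩
      exact ⟨by simpa using h1, by simpa using h2⟩
    obtain ⟨⟨u, v⟩, huv, hmax⟩ := hSc.exists_isMaxOn hSne
      (f := fun w => ‖⟪w.1, w.2⟫_ℂ‖) (by fun_prop)
    refine ⟨Fin.snoc x u, Fin.snoc y v, fun k => ?_⟩
    induction k using Fin.lastCases with
    | last =>
      have hS : principalFeasible 𝒳 𝒴 (Fin.snoc x u : Fin (j + 1) → _) (Fin.snoc y v)
          (Fin.last j) = S := by
        ext w
        simp only [principalFeasible, S, Set.mem_ofPred_eq]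
        simp [Fin.forall_fin_succ']
      rw [hS]
      simp only [Fin.snoc_last]
      exact ⟨huv, hmax⟩
    | cast k =>
      have hS : principalFeasible 𝒳 𝒴 (Fin.snoc x u : Fin (j + 1) → _) (Fin.snoc y v)
          k.castSucc = principalFeasible 𝒳 𝒴 x y k := by
        ext w
        simp only [principalFeasible, Set.mem_ofPred_eq]
        have : ¬ Fin.last j < k.castSucc := not_lt.mpr (Fin.le_last _)
        simp [Fin.forall_fin_succ', this]
      rw [hS]
      simp only [Fin.snoc_castSucc]
      exact hxy k

/-- Principal angles exist for any two subspaces. -/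
theorem exists_isPrincipalAngles {n : ℕ} (𝒳 𝒴 : Submodule ℂ (EuclideanSpace ℂ (Fin n))) :
    ∃ θ, IsPrincipalAngles 𝒳 𝒴 θ := by
  obtain ⟨x, y, hxy⟩ := exists_isPrincipalVectors 𝒳 𝒴 _ le_rfl
  refine ⟨fun k => Real.arccos ‖⟪x k, y k⟫_ℂ‖, x, y, hxy, fun k => ⟨⟨Real.arccos_nonneg _, ?_⟩, ?_⟩⟩
  · exact Real.arccos_le_pi_div_two.mpr (norm_nonneg _)
  · obtain ⟨-, -, h1, h2, -⟩ := (hxy k).1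
    refine Real.cos_arccos (by linarith [norm_nonneg ⟪x k, y k⟫_ℂ]) ?_
    have := norm_inner_le_norm (𝕜 := ℂ) (x k) (y k)
    simp only at h1 h2
    rwa [h1, h2, mul_one] at this

/-! ### Moore–Penrose pseudoinverse -/

/-- The four Penrose equations. -/
structure IsMoorePenrose {a b : ℕ} (A : Matrix (Fin a) (Fin b) ℂ)
    (B : Matrix (Fin b) (Fin a) ℂ) : Prop where
  mul_mul_left : A * B * A = A
  mul_mul_right : B * A * B = B
  isHermitian_left : (A * B)ᴴ = A * B
  isHermitian_right : (B * A)ᴴ = B * A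

theorem IsMoorePenrose.unique {a b : ℕ} {A : Matrix (Fin a) (Fin b) ℂ}
    {B C : Matrix (Fin b) (Fin a) ℂ} (hB : IsMoorePenrose A B) (hC : IsMoorePenrose A C) :
    B = C := by
  have h1 : A * B = A * C := by
    calc A * B = (A * B)ᴴ := hB.isHermitian_left.symm
      _ = (A * C * (A * B))ᴴ := by
        rw [← Matrix.mul_assoc, hC.mul_mul_left]
      _ = (A * B) * (A * C) := by
        rw [Matrix.conjTranspose_mul, hB.isHermitian_left, hC.isHermitian_left]
      _ = A * C := by rw [← Matrix.mul_assoc, hB.mul_mul_left]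
  have h2 : B * A = C * A := by
    calc B * A = (B * A)ᴴ := hB.isHermitian_right.symm
      _ = (B * A * (C * A))ᴴ := by
        rw [Matrix.mul_assoc B A, ← Matrix.mul_assoc A C, hC.mul_mul_left]
      _ = (C * A) * (B * A) := by
        rw [Matrix.conjTranspose_mul, hB.isHermitian_right, hC.isHermitian_right]
      _ = C * A := by rw [Matrix.mul_assoc C A, ← Matrix.mul_assoc A B, hB.mul_mul_left]
  calc B = B * (A * B) := by rw [← Matrix.mul_assoc, hB.mul_mul_right]
    _ = C * A * C := by rw [h1, ← Matrix.mul_assoc, h2]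
    _ = C := hC.mul_mul_right

open scoped ComplexOrder in
theorem exists_isMoorePenrose {a b : ℕ} (A : Matrix (Fin a) (Fin b) ℂ) :
    ∃ B, IsMoorePenrose A B := by
  obtain ⟨G, hG, hGH, hHGH, hGHG, hcomm⟩ : ∃ G : Matrix (Fin b) (Fin b) ℂ, Gᴴ = G ∧
      (G * (Aᴴ * A))ᴴ = G * (Aᴴ * A) ∧ Aᴴ * A * G * (Aᴴ * A) = Aᴴ * A ∧
      G * (Aᴴ * A) * G = G ∧ G * (Aᴴ * A) = Aᴴ * A * G := by
    obtain ⟨U, ev, hUU, hs⟩ : ∃ (U : Matrix (Fin b) (Fin b) ℂ) (ev : Fin b → ℝ), Uᴴ * U = 1 ∧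
        Aᴴ * A = U * Matrix.diagonal (fun i => (ev i : ℂ)) * Uᴴ := by
      have hH := Matrix.isHermitian_conjTranspose_mul_self A
      refine ⟨hH.eigenvectorUnitary.1, hH.eigenvalues, ?_, ?_⟩
      · exact Unitary.coe_star_mul_self hH.eigenvectorUnitary
      · conv_lhs => rw [hH.spectral_theorem]
        rfl
    have key : ∀ e f : Fin b → ℂ, U * Matrix.diagonal e * Uᴴ * (U * Matrix.diagonal f * Uᴴ) =
        U * Matrix.diagonal (fun i => e i * f i) * Uᴴ := by
      intro e f
      rw [← Matrix.diagonal_mul_diagonal]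
      calc _ = U * Matrix.diagonal e * (Uᴴ * U) * Matrix.diagonal f * Uᴴ := by
            simp only [Matrix.mul_assoc]
        _ = _ := by rw [hUU]; simp only [Matrix.mul_assoc, Matrix.one_mul]
    have herm : ∀ e : Fin b → ℝ, (U * Matrix.diagonal (fun i => (e i : ℂ)) * Uᴴ)ᴴ =
        U * Matrix.diagonal (fun i => (e i : ℂ)) * Uᴴ := by
      intro e
      simp only [Matrix.conjTranspose_mul, Matrix.conjTranspose_conjTranspose,
        Matrix.diagonal_conjTranspose, Matrix.mul_assoc]
      congr 3
      ext i
      simp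
    refine ⟨U * Matrix.diagonal (fun i => (((ev i)⁻¹ : ℝ) : ℂ)) * Uᴴ, herm _, ?_⟩
    rw [hs]
    simp only [key]
    refine ⟨?_, ?_, ?_, ?_⟩
    · have := herm (fun i => (ev i)⁻¹ * ev i)
      simpa using this
    · congr 3; ext i; simp [mul_inv_mul_cancel]
    · congr 3; ext i; by_cases h : ev i = 0 <;> simp [h]
    · congr 3; ext i; simp [mul_comm]
  have hA : A * G * (Aᴴ * A) = A := by
    have h0 : (A * G * (Aᴴ * A) - A)ᴴ * (A * G * (Aᴴ * A) - A) = 0 := by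
      have e1 : (A * G * (Aᴴ * A))ᴴ = Aᴴ * A * G * Aᴴ := by
        simp only [Matrix.conjTranspose_mul, hG, Matrix.conjTranspose_conjTranspose,
          Matrix.mul_assoc]
      rw [Matrix.conjTranspose_sub, e1, Matrix.sub_mul, Matrix.mul_sub, Matrix.mul_sub]
      have e2 : Aᴴ * A * G * Aᴴ * (A * G * (Aᴴ * A)) = Aᴴ * A := by
        calc _ = (Aᴴ * A * G * (Aᴴ * A)) * G * (Aᴴ * A) := by simp only [Matrix.mul_assoc]
          _ = _ := by rw [hHGH, hHGH]
      have e3 : Aᴴ * A * G * Aᴴ * A = Aᴴ * A := by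
        calc _ = Aᴴ * A * G * (Aᴴ * A) := by simp only [Matrix.mul_assoc]
          _ = _ := hHGH
      have e4 : Aᴴ * (A * G * (Aᴴ * A)) = Aᴴ * A := by
        calc _ = Aᴴ * A * G * (Aᴴ * A) := by simp only [Matrix.mul_assoc]
          _ = _ := hHGH
      rw [e2, e3, e4]; simp
    exact sub_eq_zero.mp (Matrix.conjTranspose_mul_self_eq_zero.mp h0)
  refine ⟨G * Aᴴ, ?_, ?_, ?_, ?_⟩
  · calc _ = A * G * (Aᴴ * A) := by simp only [Matrix.mul_assoc]
      _ = A := hA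
  · calc _ = G * (Aᴴ * A) * G * Aᴴ := by simp only [Matrix.mul_assoc]
      _ = _ := by rw [hGHG]
  · simp only [Matrix.conjTranspose_mul, hG, Matrix.conjTranspose_conjTranspose, Matrix.mul_assoc]
  · rw [Matrix.mul_assoc]; exact hGH

/-- The Moore–Penrose pseudoinverse `A†`: the unique solution of the four Penrose equations. -/
noncomputable def pinv {a b : ℕ} (A : Matrix (Fin a) (Fin b) ℂ) : Matrix (Fin b) (Fin a) ℂ :=
  (exists_isMoorePenrose A).choose

theorem pinv_isMoorePenrose {a b : ℕ} (A : Matrix (Fin a) (Fin b) ℂ) :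
    IsMoorePenrose A (pinv A) :=
  (exists_isMoorePenrose A).choose_spec

/-! ### Positive singular values and QR factorization -/

/-- The positive singular values of a matrix, with multiplicity, in decreasing order. -/
noncomputable def posSingularValues {a b : ℕ} (A : Matrix (Fin a) (Fin b) ℂ) : List ℝ :=
  ((List.range b).map fun i => (Matrix.toEuclideanLin A).singularValues i).filter (0 < ·)

/-- A QR factorization `[X Y] = [Q Q⊥] [[R₁₁, R₁₂], [0, R₂₂]]`, partitioned after the columns of
`X`. The matrix `[Q Q⊥]` has orthonormal columns and the block matrix is upper triangular (entries
strictly below its main diagonal vanish). Since `Q⊥` has any number `m` of columns, this covers the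
full factorization (`m = n - p`, so that `[Q Q⊥]` is unitary) and economy-size ones. -/
structure IsBlockQR {n p q m : ℕ} (X : Matrix (Fin n) (Fin p) ℂ) (Y : Matrix (Fin n) (Fin q) ℂ)
    (Q : Matrix (Fin n) (Fin p) ℂ) (Qperp : Matrix (Fin n) (Fin m) ℂ)
    (R₁₁ : Matrix (Fin p) (Fin p) ℂ) (R₁₂ : Matrix (Fin p) (Fin q) ℂ)
    (R₂₂ : Matrix (Fin m) (Fin q) ℂ) : Prop where
  orthonormal : (Matrix.fromCols Q Qperp)ᴴ * Matrix.fromCols Q Qperp = 1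
  factorization :
    Matrix.fromCols X Y = Matrix.fromCols Q Qperp * Matrix.fromBlocks R₁₁ R₁₂ 0 R₂₂
  upper₁₁ : ∀ i j : Fin p, j < i → R₁₁ i j = 0
  upper₂₂ : ∀ (i : Fin m) (j : Fin q), (j : ℕ) < (i : ℕ) → R₂₂ i j = 0

/-! Write `T = R₂₂ R₁₂†`. The matrix `Qᴴ` gives coordinates on `R(X) = R(Q)`, while `R₁₂ = QᴴY` and
`R₂₂ = Q⊥ᴴY` hold the two components of `R(Y)`. Full rank of `XᴴY` forces `R₁₂† R₁₂ = 1`, so `T`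
sends `Qᴴv` to `Q⊥ᴴv` for `v ∈ R(Y)`, and it vanishes on the complement of `Qᴴ R(Y)`.

For principal vectors, maximality makes the projection of `y_k` to `R(X)` equal to `c_k x_k` with
`c_k = ⟪x_k, y_k⟫` (`inner_right_eq`). Existence of `T` excludes `c_k = 0`, hence the angle `π/2`.
So `T` maps the orthonormal vectors `Qᴴx_k` to the orthogonal vectors `c_k⁻¹ Q⊥ᴴy_k` of norm `tan
θ_k`, and it kills the rest of an orthonormal basis (`map_singularValues_eq_tan`). This identifies
the positive singular values with the positive tangents. The zeros are counted by `finrank_inf`: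
they number `q - rank R₂₂ = dim ker R₂₂`, the dimension of the intersection. -/

/-! ### Singular values from an orthonormal basis with orthogonal images -/

/-- In the basis `b` the operator `T*T` is diagonal with entries `s i ^ 2`; these are the roots of
its characteristic polynomial, hence its eigenvalues. Comparing multisets avoids sorting `b`. -/
theorem LinearMap.map_singularValues_eq_of_inner {E F ι : Type*}
    [NormedAddCommGroup E] [InnerProductSpace ℂ E] [FiniteDimensional ℂ E]
    [NormedAddCommGroup F] [InnerProductSpace ℂ F] [FiniteDimensional ℂ F]
    [Fintype ι] [DecidableEq ι] (T : E →ₗ[ℂ] F) (b : OrthonormalBasis ι ℂ E) (s : ι → ℝ)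
    (hs : ∀ i, 0 ≤ s i)
    (h : ∀ i j, ⟪T (b i), T (b j)⟫_ℂ = if i = j then ((s i ^ 2 : ℝ) : ℂ) else 0)
    {p : ℕ} (hp : Module.finrank ℂ E = p) :
    (Multiset.range p).map T.singularValues = Finset.univ.val.map s := by
  have hT := T.isSymmetric_adjoint_comp_self
  have hmat : (T.adjoint ∘ₗ T).toMatrix b.toBasis b.toBasis =
      Matrix.diagonal fun i => ((s i ^ 2 : ℝ) : ℂ) := by
    ext i j
    rw [LinearMap.toMatrix_apply, OrthonormalBasis.coe_toBasis_repr_apply,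
      OrthonormalBasis.repr_apply_apply, OrthonormalBasis.coe_toBasis, LinearMap.comp_apply,
      LinearMap.adjoint_inner_right, h, Matrix.diagonal_apply]
  have hroots : (T.adjoint ∘ₗ T).charpoly.roots =
      Finset.univ.val.map fun i => ((s i ^ 2 : ℝ) : ℂ) := by
    rw [← LinearMap.charpoly_toMatrix _ b.toBasis, hmat, Matrix.charpoly_diagonal,
      Polynomial.roots_prod _ _
        (Finset.prod_ne_zero_iff.mpr fun i _ => Polynomial.X_sub_C_ne_zero _)]
    simp only [Polynomial.roots_X_sub_C, Multiset.bind_singleton]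
  rw [hT.roots_charpoly_eq_eigenvalues hp] at hroots
  have hroots' := congrArg (Multiset.map fun z : ℂ => √z.re) hroots
  simp only [Multiset.map_map, Function.comp_def] at hroots'
  calc (Multiset.range p).map T.singularValues
      = Finset.univ.val.map fun i : Fin p => T.singularValues i := by
        rw [Fin.univ_val_map, List.ofFn_eq_map, ← Multiset.coe_range, Multiset.map_coe,
          ← List.map_coe_finRange_eq_range, List.map_map]
        rfl
    _ = Finset.univ.val.map fun i : Fin p => √(hT.eigenvalues hp i) := by
        simp only [T.singularValues_fin hp]
    _ = Finset.univ.val.map s := by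
        refine Eq.trans ?_ (hroots'.trans (Multiset.map_congr rfl fun i _ => ?_))
        · simp
        · rw [Complex.ofReal_re, Real.sqrt_sq (hs i)]

/-! ### Principal vectors -/

namespace IsPrincipalVectors

variable {n m : ℕ} {𝒳 𝒴 : Submodule ℂ (EuclideanSpace ℂ (Fin n))}
  {x y : Fin m → EuclideanSpace ℂ (Fin n)}

theorem symm (h : IsPrincipalVectors 𝒳 𝒴 x y) : IsPrincipalVectors 𝒴 𝒳 y x := by
  intro k
  obtain ⟨⟨h1, h2, h3, h4, h5⟩, hmax⟩ := h k
  refine ⟨⟨h2, h1, h4, h3, fun i hi => (h5 i hi).symm⟩, ?_⟩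
  rintro ⟨v, u⟩ ⟨g1, g2, g3, g4, g5⟩
  have := hmax (u, v) ⟨g2, g1, g4, g3, fun i hi => (g5 i hi).symm⟩
  rwa [norm_inner_symm u v, norm_inner_symm (x k) (y k)] at this

theorem left_mem (h : IsPrincipalVectors 𝒳 𝒴 x y) (k : Fin m) : x k ∈ 𝒳 := (h k).1.1

theorem orthonormal_left (h : IsPrincipalVectors 𝒳 𝒴 x y) : Orthonormal ℂ x := by
  refine ⟨fun k => (h k).1.2.2.1, fun i j hij => ?_⟩
  rcases lt_or_gt_of_ne hij with hlt | hlt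
  · exact ((h j).1.2.2.2.2 i hlt).1
  · exact inner_eq_zero_symm.mp ((h i).1.2.2.2.2 j hlt).1

/-- Otherwise the projection `z` of `y k` to the span of `x k` and `u`, once normalized, is feasible
and pairs with `y k` to `‖z‖ > ‖⟪x k, y k⟫‖`, against maximality. -/
theorem inner_eq_zero_of_orthogonal (h : IsPrincipalVectors 𝒳 𝒴 x y) (k : Fin m)
    {u : EuclideanSpace ℂ (Fin n)} (hu : u ∈ 𝒳) (hux : ∀ i ≤ k, ⟪x i, u⟫_ℂ = 0) :
    ⟪u, y k⟫_ℂ = 0 := by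
  by_contra hne
  have hu0 : u ≠ 0 := by rintro rfl; simp at hne
  obtain ⟨⟨h1, h2, h3, h4, h5⟩, hmax⟩ := h k
  simp only at h1 h2 h3 h4 h5 hmax
  set a : ℂ := ⟪x k, y k⟫_ℂ
  set t : ℂ := ⟪u, y k⟫_ℂ / ((‖u‖ : ℝ) : ℂ) ^ 2
  have hun : (‖u‖ : ℝ) ≠ 0 := norm_ne_zero_iff.mpr hu0
  set z := a • x k + t • u with hz
  have hort : ⟪a • x k, t • u⟫_ℂ = 0 := by
    rw [inner_smul_left, inner_smul_right, hux k le_rfl]; simp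
  have hnz : ‖z‖ ^ 2 = ‖a‖ ^ 2 + ‖⟪u, y k⟫_ℂ‖ ^ 2 / ‖u‖ ^ 2 := by
    have := norm_add_sq_eq_norm_sq_add_norm_sq_of_inner_eq_zero _ _ hort
    rw [sq, this, norm_smul, norm_smul, h3]
    simp only [t, norm_div, norm_pow, Complex.norm_real, Real.norm_eq_abs, abs_norm]
    field_simp
  have hzy : ⟪z, y k⟫_ℂ = ((‖z‖ ^ 2 : ℝ) : ℂ) := by
    rw [hnz, hz, inner_add_left, inner_smul_left, inner_smul_left]
    simp only [t, map_div₀, map_pow, Complex.conj_ofReal]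
    rw [Complex.conj_mul', div_mul_eq_mul_div, Complex.conj_mul']
    push_cast
    rfl
  have hpos : 0 < ‖⟪u, y k⟫_ℂ‖ ^ 2 / ‖u‖ ^ 2 := by
    have := norm_pos_iff.mpr hne
    positivity
  have hz0 : 0 < ‖z‖ := by
    refine lt_of_le_of_ne (norm_nonneg _) fun h0 => ?_
    rw [← h0] at hnz
    nlinarith [sq_nonneg ‖a‖]
  have hle := hmax (((‖z‖⁻¹ : ℝ) : ℂ) • z, y k) ⟨?_, h2, ?_, h4, fun i hi => ⟨?_, (h5 i hi).2⟩⟩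
  · simp only [inner_smul_left, hzy, Complex.conj_ofReal, norm_mul, Complex.norm_real,
      Real.norm_eq_abs, abs_inv, abs_norm, abs_pow] at hle
    have : ‖z‖ ≤ ‖a‖ := by
      refine le_trans (le_of_eq ?_) hle
      field_simp
    nlinarith [norm_nonneg a]
  · exact 𝒳.smul_mem _ (𝒳.add_mem (𝒳.smul_mem _ h1) (𝒳.smul_mem _ hu))
  · rw [norm_smul]; simp [hz0.ne']
  · simp [hz, (h5 i hi).1, hux i hi.le]

/-- The vector of larger index is orthogonal to its own family up to the smaller index, so
`inner_eq_zero_of_orthogonal` applies, with the roles swapped if `i < k`. -/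
theorem inner_eq_zero_of_ne (h : IsPrincipalVectors 𝒳 𝒴 x y) {i k : Fin m} (hik : i ≠ k) :
    ⟪x i, y k⟫_ℂ = 0 := by
  rcases lt_or_gt_of_ne hik with hlt | hlt
  · exact inner_eq_zero_symm.mp (h.symm.inner_eq_zero_of_orthogonal i (h.symm.left_mem k)
      fun j hj => h.symm.orthonormal_left.2 (hj.trans_lt hlt).ne)
  · exact h.inner_eq_zero_of_orthogonal k (h.left_mem i)
      fun j hj => h.orthonormal_left.2 (hj.trans_lt hlt).ne

/-- The orthogonal projection of `y k` to `𝒳` is a multiple of `x k`. -/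
theorem inner_right_eq (h : IsPrincipalVectors 𝒳 𝒴 x y) (k : Fin m)
    {u : EuclideanSpace ℂ (Fin n)} (hu : u ∈ 𝒳) :
    ⟪u, y k⟫_ℂ = ⟪u, x k⟫_ℂ * ⟪x k, y k⟫_ℂ := by
  have hx := h.orthonormal_left
  -- Removing from `u` its components along all `x i` does not change the pairing with `y k`, beyond
  -- the single term `i = k`.
  have h0 := h.inner_eq_zero_of_orthogonal k (u := u - ∑ i, ⟪x i, u⟫_ℂ • x i)
    (𝒳.sub_mem hu (𝒳.sum_mem fun i _ => 𝒳.smul_mem _ (h.left_mem i)))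
    (fun i _ => by rw [inner_sub_right, hx.inner_right_fintype, sub_self])
  rw [inner_sub_left, sub_eq_zero] at h0
  rw [h0, sum_inner, Finset.sum_eq_single k]
  · rw [inner_smul_left, inner_conj_symm]
  · intro i _ hi
    rw [inner_smul_left, h.inner_eq_zero_of_ne hi, mul_zero]
  · simp

theorem antitone_norm_inner (h : IsPrincipalVectors 𝒳 𝒴 x y) :
    Antitone fun k => ‖⟪x k, y k⟫_ℂ‖ := by
  intro k l hkl
  obtain ⟨h1, h2, h3, h4, h5⟩ := (h l).1
  exact (h k).2 (x l, y l) ⟨h1, h2, h3, h4, fun i hi => h5 i (hi.trans_le hkl)⟩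

end IsPrincipalVectors

theorem Real.tan_sq_eq_one_sub_cos_sq_div (θ : ℝ) :
    Real.tan θ ^ 2 = (1 - Real.cos θ ^ 2) / Real.cos θ ^ 2 := by
  rw [Real.tan_eq_sin_div_cos, div_pow, Real.sin_sq]

/-- Suppose `A` is a coisometry with initial space `𝒳`, and `y ↦ (A y, B y)` is isometric on `𝒴`.
If `T` maps `A y` to `B y` for `y ∈ 𝒴` and vanishes on the orthogonal complement of `A 𝒴`, then its
singular values are the tangents of the principal angles between `𝒳` and `𝒴`, and zeros. -/
theorem map_singularValues_eq_tan {n p N : ℕ} {G : Type*}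
    [NormedAddCommGroup G] [InnerProductSpace ℂ G] [FiniteDimensional ℂ G]
    {𝒳 𝒴 : Submodule ℂ (EuclideanSpace ℂ (Fin n))}
    (A : EuclideanSpace ℂ (Fin n) →ₗ[ℂ] EuclideanSpace ℂ (Fin p))
    (B : EuclideanSpace ℂ (Fin n) →ₗ[ℂ] G) (T : EuclideanSpace ℂ (Fin p) →ₗ[ℂ] G)
    (hAB : ∀ u ∈ 𝒴, ∀ v ∈ 𝒴, ⟪u, v⟫_ℂ = ⟪A u, A v⟫_ℂ + ⟪B u, B v⟫_ℂ)
    (hA : ∀ u ∈ 𝒳, ∀ v, ⟪A u, A v⟫_ℂ = ⟪u, v⟫_ℂ) (hAsurj : ∀ a, ∃ u ∈ 𝒳, A u = a)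
    (hT : ∀ v ∈ 𝒴, T (A v) = B v) (hT0 : ∀ a, (∀ v ∈ 𝒴, ⟪A v, a⟫_ℂ = 0) → T a = 0)
    (hN : Module.finrank ℂ 𝒴 = N) (hNp : N ≤ p)
    {x y : Fin N → EuclideanSpace ℂ (Fin n)} (hxy : IsPrincipalVectors 𝒳 𝒴 x y)
    {θ : Fin N → ℝ} (hθ : ∀ k, θ k ∈ Set.Icc 0 (Real.pi / 2) ∧ Real.cos (θ k) = ‖⟪x k, y k⟫_ℂ‖) :
    (∀ k, θ k < Real.pi / 2) ∧
      (Multiset.range p).map T.singularValues =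
        Finset.univ.val.map (fun k => Real.tan (θ k)) + Multiset.replicate (p - N) 0 := by
  have hx := hxy.orthonormal_left
  have hy := hxy.symm.orthonormal_left
  have hx𝒳 := hxy.left_mem
  have hy𝒴 := hxy.symm.left_mem
  have hu : Orthonormal ℂ fun k => A (x k) := by
    rw [orthonormal_iff_ite] at hx ⊢
    intro i j
    rw [hA _ (hx𝒳 i), hx i j]
  have hAy : ∀ k, A (y k) = ⟪x k, y k⟫_ℂ • A (x k) := by
    intro k
    refine ext_inner_left ℂ fun a => ?_
    obtain ⟨u, hu, rfl⟩ := hAsurj a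
    rw [inner_smul_right, hA u hu, hA u hu, hxy.inner_right_eq k hu, mul_comm]
  -- A zero cosine gives `A (y k) = 0`, so `B (y k) = T 0 = 0` and the isometry `(A, B)` kills a
  -- unit vector.
  have hc : ∀ k, ⟪x k, y k⟫_ℂ ≠ 0 := by
    intro k h0
    have hA0 : A (y k) = 0 := by rw [hAy, h0, zero_smul]
    have h1 := hAB _ (hy𝒴 k) _ (hy𝒴 k)
    rw [← hT _ (hy𝒴 k), hA0, map_zero, inner_zero_left, inner_zero_left, add_zero,
      inner_self_eq_zero] at h1
    exact hy.ne_zero k h1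
  have hcos : ∀ k, Real.cos (θ k) ≠ 0 := fun k => by
    rw [(hθ k).2]
    exact norm_ne_zero_iff.mpr (hc k)
  have hlt : ∀ k, θ k < Real.pi / 2 := fun k =>
    lt_of_le_of_ne (hθ k).1.2 fun h => hcos k (by rw [h, Real.cos_pi_div_two])
  refine ⟨hlt, ?_⟩
  -- Expanding `⟪y i, y j⟫` through `hAB` leaves `conj c_i * c_j * (δ_ij + ⟪T (A (x i)), T (A (x
  -- j))⟫) = δ_ij`.
  have hTu : ∀ i j, ⟪T (A (x i)), T (A (x j))⟫_ℂ =
      if i = j then ((Real.tan (θ i) ^ 2 : ℝ) : ℂ) else 0 := by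
    intro i j
    have h1 := hAB _ (hy𝒴 i) _ (hy𝒴 j)
    rw [← hT _ (hy𝒴 i), ← hT _ (hy𝒴 j), hAy, hAy, map_smul, map_smul, inner_smul_left,
      inner_smul_left, inner_smul_right, inner_smul_right, orthonormal_iff_ite.mp hy i j,
      orthonormal_iff_ite.mp hu i j] at h1
    have hci : (starRingEnd ℂ) ⟪x i, y i⟫_ℂ ≠ 0 :=
      (map_ne_zero _).mpr (hc i)
    split_ifs at h1 ⊢ with hij
    · subst hij
      rw [Real.tan_sq_eq_one_sub_cos_sq_div, (hθ i).2]
      push_cast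
      rw [← Complex.conj_mul', eq_div_iff (mul_ne_zero hci (hc i))]
      linear_combination -h1
    · have h2 : (starRingEnd ℂ) ⟪x i, y i⟫_ℂ * ⟪x j, y j⟫_ℂ * ⟪T (A (x i)), T (A (x j))⟫_ℂ = 0 := by
        linear_combination -h1
      exact (mul_eq_zero.mp h2).resolve_left (mul_ne_zero hci (hc j))
  have hspan : 𝒴 = Submodule.span ℂ (Set.range y) := by
    symm
    refine Submodule.eq_of_le_of_finrank_eq (Submodule.span_le.mpr ?_) ?_
    · rintro _ ⟨k, rfl⟩
      exact hy𝒴 k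
    · rw [finrank_span_eq_card hy.linearIndependent, Fintype.card_fin, hN]
  have hker : ∀ a, (∀ k, ⟪A (x k), a⟫_ℂ = 0) → T a = 0 := by
    refine fun a ha => hT0 a fun v hv => ?_
    rw [hspan] at hv
    induction hv using Submodule.span_induction with
    | mem v hv =>
      obtain ⟨k, rfl⟩ := hv
      rw [hAy, inner_smul_left, ha, mul_zero]
    | zero => simp
    | add v w _ _ h1 h2 => rw [map_add, inner_add_left, h1, h2, add_zero]
    | smul c v _ h1 => rw [map_smul, inner_smul_left, h1, mul_zero]
  obtain ⟨b, hb⟩ := Orthonormal.exists_orthonormalBasis_extension_of_card_eq (𝕜 := ℂ)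
    (E := EuclideanSpace ℂ (Fin p)) (ι := Fin N ⊕ Fin (p - N)) (by simp; omega)
    (v := Sum.elim (fun k => A (x k)) 0) (s := Set.range Sum.inl) (by
      rw [orthonormal_iff_ite] at hu ⊢
      rintro ⟨_, i, rfl⟩ ⟨_, j, rfl⟩
      simpa [Subtype.ext_iff] using hu i j)
  have hbl : ∀ k, b (Sum.inl k) = A (x k) := fun k => hb _ ⟨k, rfl⟩
  have hbr : ∀ j, T (b (Sum.inr j)) = 0 := fun j => hker _ fun k => by
    rw [← hbl, b.orthonormal.2 (by simp)]
  have := T.map_singularValues_eq_of_inner b (Sum.elim (fun k => Real.tan (θ k)) 0)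
    (by
      rintro (k | j)
      · exact Real.tan_nonneg_of_nonneg_of_le_pi_div_two (hθ k).1.1 (hθ k).1.2
      · exact le_rfl)
    (by
      rintro (i | i) (j | j)
      · simp only [hbl, hTu, Sum.inl.injEq, Sum.elim_inl]
      · simp [hbr]
      · simp [hbr]
      · simp [hbr])
    (p := p) (by simp)
  rw [this, ← Finset.univ_disjSum_univ, Finset.val_disjSum]
  simp only [Multiset.disjSum, Multiset.map_add, Multiset.map_map, Function.comp_def, Sum.elim_inl,
    Sum.elim_inr, Pi.zero_apply, Multiset.map_const', Finset.card_val, Finset.card_fin]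

/-! ### Matrices as linear maps -/

theorem Matrix.toEuclideanLin_mul_apply {a b c : ℕ} (A : Matrix (Fin a) (Fin b) ℂ)
    (B : Matrix (Fin b) (Fin c) ℂ) (v : EuclideanSpace ℂ (Fin c)) :
    Matrix.toEuclideanLin (A * B) v = Matrix.toEuclideanLin A (Matrix.toEuclideanLin B v) := by
  simp [Matrix.toLpLin_apply, Matrix.mulVec_mulVec]

theorem Matrix.inner_toEuclideanLin_right {a b : ℕ} (A : Matrix (Fin a) (Fin b) ℂ)
    (v : EuclideanSpace ℂ (Fin a)) (w : EuclideanSpace ℂ (Fin b)) :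
    ⟪v, Matrix.toEuclideanLin A w⟫_ℂ = ⟪Matrix.toEuclideanLin Aᴴ v, w⟫_ℂ := by
  rw [Matrix.toEuclideanLin_conjTranspose_eq_adjoint, LinearMap.adjoint_inner_left]

theorem finrank_colRange {a b : ℕ} (A : Matrix (Fin a) (Fin b) ℂ) :
    Module.finrank ℂ (colRange A) = A.rank := by
  exact (A.rank_eq_finrank_range_toLin (PiLp.basisFun 2 ℂ (Fin a)) (PiLp.basisFun 2 ℂ (Fin b))).symm

theorem colRange_mul_le {a b c : ℕ} (A : Matrix (Fin a) (Fin b) ℂ)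
    (B : Matrix (Fin b) (Fin c) ℂ) : colRange (A * B) ≤ colRange A := by
  rintro _ ⟨v, rfl⟩
  exact ⟨Matrix.toEuclideanLin B v, (Matrix.toEuclideanLin_mul_apply A B v).symm⟩

theorem Matrix.toEuclideanLin_injective_of_rank_eq {a b : ℕ} {A : Matrix (Fin a) (Fin b) ℂ}
    (hA : A.rank = b) : Function.Injective (Matrix.toEuclideanLin A) := by
  have h := (Matrix.toEuclideanLin A).finrank_range_add_finrank_ker
  have h2 := finrank_colRange A
  rw [colRange] at h2
  rw [finrank_euclideanSpace_fin] at h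
  exact LinearMap.ker_eq_bot.mp (Submodule.finrank_eq_zero.mp (by omega))

theorem pinv_mul_self_of_rank_eq {a b : ℕ} {A : Matrix (Fin a) (Fin b) ℂ}
    (hA : A.rank = b) : pinv A * A = 1 := by
  refine Matrix.toEuclideanLin.injective (LinearMap.ext fun v => ?_)
  refine Matrix.toEuclideanLin_injective_of_rank_eq hA ?_
  rw [← Matrix.toEuclideanLin_mul_apply, ← Matrix.mul_assoc,
    (pinv_isMoorePenrose A).mul_mul_left, Matrix.toLpLin_one, LinearMap.id_apply]

/-- The pseudoinverse vanishes on the orthogonal complement of the column range. -/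
theorem toEuclideanLin_pinv_eq_zero {a b : ℕ} {A : Matrix (Fin a) (Fin b) ℂ}
    {w : EuclideanSpace ℂ (Fin a)} (hw : ∀ v, ⟪Matrix.toEuclideanLin A v, w⟫_ℂ = 0) :
    Matrix.toEuclideanLin (pinv A) w = 0 := by
  have hp := pinv_isMoorePenrose A
  have h0 : Matrix.toEuclideanLin (A * pinv A) w = 0 := by
    refine ext_inner_left ℂ fun v => ?_
    rw [Matrix.inner_toEuclideanLin_right, hp.isHermitian_left, Matrix.toEuclideanLin_mul_apply,
      hw, inner_zero_right]
  rw [← hp.mul_mul_right, Matrix.mul_assoc, Matrix.toEuclideanLin_mul_apply, h0, map_zero]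

/-! ### Positive singular values -/

theorem posSingularValues_pairwise {a b : ℕ} (A : Matrix (Fin a) (Fin b) ℂ) :
    (posSingularValues A).Pairwise (· ≥ ·) := by
  refine List.Pairwise.filter _ (List.pairwise_map.mpr ?_)
  exact List.pairwise_lt_range.imp fun h =>
    (Matrix.toEuclideanLin A).singularValues_antitone h.le

theorem length_posSingularValues {a b : ℕ} (A : Matrix (Fin a) (Fin b) ℂ) :
    (posSingularValues A).length = A.rank := by
  have hr := finrank_colRange A
  rw [colRange] at hr
  rw [posSingularValues, List.filter_map, List.length_map]
  simp only [Function.comp_def, LinearMap.singularValues_pos_iff_lt_finrank_range, hr]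
  change ((Finset.range b).filter (· < A.rank)).card = A.rank
  have hle := A.rank_le_width
  have : (Finset.range b).filter (· < A.rank) = Finset.range A.rank := by
    ext i
    simp only [Finset.mem_filter, Finset.mem_range]
    omega
  rw [this, Finset.card_range]

/-! ### QR factorization -/

namespace IsBlockQR

variable {n p q m : ℕ} {X : Matrix (Fin n) (Fin p) ℂ} {Y : Matrix (Fin n) (Fin q) ℂ}
  {Q : Matrix (Fin n) (Fin p) ℂ} {Qperp : Matrix (Fin n) (Fin m) ℂ}
  {R₁₁ : Matrix (Fin p) (Fin p) ℂ} {R₁₂ : Matrix (Fin p) (Fin q) ℂ}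
  {R₂₂ : Matrix (Fin m) (Fin q) ℂ}

theorem gram_blocks (h : IsBlockQR X Y Q Qperp R₁₁ R₁₂ R₂₂) :
    Qᴴ * Q = 1 ∧ Qᴴ * Qperp = 0 ∧ Qperpᴴ * Q = 0 ∧ Qperpᴴ * Qperp = 1 := by
  have := h.orthonormal
  rw [Matrix.conjTranspose_fromCols_eq_fromRows_conjTranspose, Matrix.fromRows_mul_fromCols,
    ← Matrix.fromBlocks_one, Matrix.fromBlocks_inj] at this
  exact this

theorem eq_mul (h : IsBlockQR X Y Q Qperp R₁₁ R₁₂ R₂₂) :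
    X = Q * R₁₁ ∧ Y = Q * R₁₂ + Qperp * R₂₂ := by
  have := h.factorization
  rw [Matrix.fromCols_mul_fromBlocks, Matrix.mul_zero, add_zero] at this
  exact Matrix.fromCols_inj this

theorem conjTranspose_mul_right (h : IsBlockQR X Y Q Qperp R₁₁ R₁₂ R₂₂) : Qᴴ * Y = R₁₂ := by
  obtain ⟨h1, h2, -, -⟩ := h.gram_blocks
  rw [h.eq_mul.2, Matrix.mul_add, ← Matrix.mul_assoc, ← Matrix.mul_assoc, h1, h2]
  simp

theorem conjTranspose_perp_mul_right (h : IsBlockQR X Y Q Qperp R₁₁ R₁₂ R₂₂) :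
    Qperpᴴ * Y = R₂₂ := by
  obtain ⟨-, -, h1, h2⟩ := h.gram_blocks
  rw [h.eq_mul.2, Matrix.mul_add, ← Matrix.mul_assoc, ← Matrix.mul_assoc, h1, h2]
  simp

open scoped ComplexOrder in
theorem rank_Q (h : IsBlockQR X Y Q Qperp R₁₁ R₁₂ R₂₂) : Q.rank = p := by
  rw [← Matrix.rank_conjTranspose_mul_self, h.gram_blocks.1, Matrix.rank_one, Fintype.card_fin]

theorem le_dim (h : IsBlockQR X Y Q Qperp R₁₁ R₁₂ R₂₂) : p ≤ n :=
  h.rank_Q ▸ Q.rank_le_height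

theorem rank_left (h : IsBlockQR X Y Q Qperp R₁₁ R₁₂ R₂₂) (hX : IsFullRank X) : X.rank = p := by
  rw [hX, min_eq_right h.le_dim]

theorem colRange_left (h : IsBlockQR X Y Q Qperp R₁₁ R₁₂ R₂₂) (hX : IsFullRank X) :
    colRange X = colRange Q := by
  refine Submodule.eq_of_le_of_finrank_eq ?_ ?_
  · rw [h.eq_mul.1]
    exact colRange_mul_le _ _
  · rw [finrank_colRange, finrank_colRange, h.rank_left hX, h.rank_Q]

/-- Since `XᴴY = R₁₁ᴴ R₁₂`, the rank `q` of the product bounds that of `R₁₂` from below. -/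
theorem rank_R₁₂ (h : IsBlockQR X Y Q Qperp R₁₁ R₁₂ R₂₂) (hqp : q ≤ p)
    (hXY : IsFullRank (Xᴴ * Y)) : R₁₂.rank = q := by
  have h1 : Xᴴ * Y = R₁₁ᴴ * R₁₂ := by
    rw [h.eq_mul.1, Matrix.conjTranspose_mul, Matrix.mul_assoc, h.conjTranspose_mul_right]
  have h2 := Matrix.rank_mul_le_right R₁₁ᴴ R₁₂
  rw [← h1, hXY, min_eq_right hqp] at h2
  exact le_antisymm R₁₂.rank_le_width h2

theorem mul_pinv_mul (h : IsBlockQR X Y Q Qperp R₁₁ R₁₂ R₂₂) (hqp : q ≤ p)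
    (hXY : IsFullRank (Xᴴ * Y)) : R₂₂ * pinv R₁₂ * R₁₂ = R₂₂ := by
  rw [Matrix.mul_assoc, pinv_mul_self_of_rank_eq (h.rank_R₁₂ hqp hXY), Matrix.mul_one]

/-- Each of `R₂₂ R₁₂†` and `R₂₂` is a right multiple of the other. -/
theorem rank_mul_pinv (h : IsBlockQR X Y Q Qperp R₁₁ R₁₂ R₂₂) (hqp : q ≤ p)
    (hXY : IsFullRank (Xᴴ * Y)) : (R₂₂ * pinv R₁₂).rank = R₂₂.rank := by
  refine le_antisymm (Matrix.rank_mul_le_left _ _) ?_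
  conv_lhs => rw [← h.mul_pinv_mul hqp hXY]
  exact Matrix.rank_mul_le_left _ _

/-- `QQᴴ + Q⊥Q⊥ᴴ` fixes `R(Y)` even when `[Q Q⊥]` is not unitary, so one argument in `R(Y)`
suffices. -/
theorem inner_eq_add (h : IsBlockQR X Y Q Qperp R₁₁ R₁₂ R₂₂)
    {u v : EuclideanSpace ℂ (Fin n)} (hv : v ∈ colRange Y) :
    ⟪u, v⟫_ℂ = ⟪Matrix.toEuclideanLin Qᴴ u, Matrix.toEuclideanLin Qᴴ v⟫_ℂ +
      ⟪Matrix.toEuclideanLin Qperpᴴ u, Matrix.toEuclideanLin Qperpᴴ v⟫_ℂ := by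
  obtain ⟨z, rfl⟩ := hv
  rw [← Matrix.inner_toEuclideanLin_right, ← Matrix.inner_toEuclideanLin_right, ← inner_add_right]
  simp only [← Matrix.toEuclideanLin_mul_apply]
  rw [h.conjTranspose_mul_right, h.conjTranspose_perp_mul_right, ← LinearMap.add_apply,
    ← map_add, ← h.eq_mul.2]

/-- `Yz` lies in `R(Q)` exactly when `R₂₂ z = 0`; rank–nullity for `R₂₂` and injectivity of `Y` do
the rest. -/
theorem finrank_inf (h : IsBlockQR X Y Q Qperp R₁₁ R₁₂ R₂₂) (hX : IsFullRank X)
    (hYr : Y.rank = q) :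
    R₂₂.rank + Module.finrank ℂ
      (colRange X ⊓ colRange Y : Submodule ℂ (EuclideanSpace ℂ (Fin n))) = q := by
  have hinf : colRange X ⊓ colRange Y =
      (LinearMap.ker (Matrix.toEuclideanLin R₂₂)).map (Matrix.toEuclideanLin Y) := by
    obtain ⟨-, -, h1, -⟩ := h.gram_blocks
    rw [h.colRange_left hX]
    ext v
    constructor
    · rintro ⟨⟨w, hw⟩, z, rfl⟩
      refine ⟨z, ?_, rfl⟩
      change Matrix.toEuclideanLin R₂₂ z = 0
      rw [← h.conjTranspose_perp_mul_right, Matrix.toEuclideanLin_mul_apply, ← hw,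
        ← Matrix.toEuclideanLin_mul_apply, h1, map_zero, LinearMap.zero_apply]
    · rintro ⟨z, hz, rfl⟩
      have hz' : Matrix.toEuclideanLin R₂₂ z = 0 := hz
      refine ⟨⟨Matrix.toEuclideanLin R₁₂ z, ?_⟩, z, rfl⟩
      rw [h.eq_mul.2, map_add, LinearMap.add_apply, Matrix.toEuclideanLin_mul_apply,
        Matrix.toEuclideanLin_mul_apply, hz', map_zero, add_zero]
  rw [hinf, ← (Submodule.equivMapOfInjective _
    (Matrix.toEuclideanLin_injective_of_rank_eq hYr) _).finrank_eq, ← finrank_colRange, colRange,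
    LinearMap.finrank_range_add_finrank_ker, finrank_euclideanSpace_fin]

end IsBlockQR

/-! ### Sorted lists -/

/-- A decreasing list is determined by its multiset; the nonpositive entries are all `0`, and the
lengths count them. -/
theorem List.eq_filter_pos_append_replicate {l l' : List ℝ} (hl : l.Pairwise (· ≥ ·))
    (hl0 : ∀ a ∈ l, 0 ≤ a) (hl' : l'.Pairwise (· ≥ ·)) (hpos : ∀ a ∈ l', 0 < a) {d : ℕ}
    (hlen : l.length = l'.length + d) (hperm : (l.filter (0 < ·)).Perm l') :
    l = l' ++ List.replicate d 0 := by
  have h1 : l.filter (fun a => !decide (0 < a)) = List.replicate d 0 := by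
    rw [List.eq_replicate_iff]
    constructor
    · have := List.length_eq_length_filter_add (l := l) (fun a => decide (0 < a))
      have := hperm.length_eq
      omega
    · intro a ha
      exact le_antisymm (by simpa using (List.mem_filter.mp ha).2) (hl0 a (List.mem_filter.mp ha).1)
  refine List.Perm.eq_of_pairwise' hl ?_ ?_
  · rw [List.pairwise_append]
    refine ⟨hl', List.pairwise_replicate.mpr (Or.inr le_rfl), fun a ha b hb => ?_⟩
    rw [List.eq_of_mem_replicate hb]
    exact (hpos a ha).le
  · rw [← h1]
    exact (List.filter_append_perm (fun a => decide (0 < a)) l).symm.trans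
      (hperm.append (List.Perm.refl _))

theorem corollary3p5 {n p q m : ℕ} (hqp : q ≤ p)
    (X : Matrix (Fin n) (Fin p) ℂ) (Y : Matrix (Fin n) (Fin q) ℂ)
    (hX : IsFullRank X) (hY : IsFullRank Y) (hXY : IsFullRank (Xᴴ * Y))
    (Q : Matrix (Fin n) (Fin p) ℂ) (Qperp : Matrix (Fin n) (Fin m) ℂ)
    (R₁₁ : Matrix (Fin p) (Fin p) ℂ) (R₁₂ : Matrix (Fin p) (Fin q) ℂ)
    (R₂₂ : Matrix (Fin m) (Fin q) ℂ)
    (hQR : IsBlockQR X Y Q Qperp R₁₁ R₁₂ R₂₂)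
    (θ : Fin (min (Module.finrank ℂ (colRange X)) (Module.finrank ℂ (colRange Y))) → ℝ)
    (hθ : IsPrincipalAngles (colRange X) (colRange Y) θ) :
    (∀ k, θ k < Real.pi / 2) ∧
      (List.ofFn fun k => Real.tan (θ k)).reverse =
        posSingularValues (R₂₂ * pinv R₁₂) ++
          List.replicate
            (Module.finrank ℂ (colRange X ⊓ colRange Y : Submodule ℂ (EuclideanSpace ℂ (Fin n))))
            0 := by
  obtain ⟨x, y, hxy, hxyθ⟩ := hθ
  have hYr : Y.rank = q := by rw [hY, min_eq_right (hqp.trans hQR.le_dim)]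
  have hN : min (Module.finrank ℂ (colRange X)) (Module.finrank ℂ (colRange Y)) = q := by
    rw [finrank_colRange, finrank_colRange, hQR.rank_left hX, hYr, min_eq_right hqp]
  obtain ⟨h1, -, -, -⟩ := hQR.gram_blocks
  obtain ⟨hlt, hsv⟩ := map_singularValues_eq_tan
    (Matrix.toEuclideanLin Qᴴ) (Matrix.toEuclideanLin Qperpᴴ)
    (Matrix.toEuclideanLin (R₂₂ * pinv R₁₂))
    (fun u _ v hv => hQR.inner_eq_add hv)
    (by
      rw [hQR.colRange_left hX]
      rintro _ ⟨w, rfl⟩ v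
      rw [← Matrix.toEuclideanLin_mul_apply, h1, Matrix.toLpLin_one, LinearMap.id_apply,
        Matrix.inner_toEuclideanLin_right, Matrix.conjTranspose_conjTranspose])
    (by
      rw [hQR.colRange_left hX]
      refine fun a => ⟨Matrix.toEuclideanLin Q a, ⟨a, rfl⟩, ?_⟩
      rw [← Matrix.toEuclideanLin_mul_apply, h1, Matrix.toLpLin_one, LinearMap.id_apply])
    (by
      rintro _ ⟨z, rfl⟩
      simp only [← Matrix.toEuclideanLin_mul_apply]
      rw [hQR.conjTranspose_mul_right, hQR.conjTranspose_perp_mul_right,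
        hQR.mul_pinv_mul hqp hXY])
    (by
      intro a ha
      rw [Matrix.toEuclideanLin_mul_apply, toEuclideanLin_pinv_eq_zero, map_zero]
      intro z
      rw [← hQR.conjTranspose_mul_right, Matrix.toEuclideanLin_mul_apply]
      exact ha _ ⟨z, rfl⟩)
    (by rw [hN, finrank_colRange, hYr]) (hN.trans_le hqp) hxy hxyθ
  refine ⟨hlt, ?_⟩
  -- The maxima `cos θ_k` decrease as constraints accumulate, so the angles and tangents increase;
  -- hence the reversal in the statement.
  have hmono : Monotone fun k => Real.tan (θ k) := by
    intro k l hkl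
    refine Real.strictMonoOn_tan.monotoneOn ⟨?_, hlt k⟩ ⟨?_, hlt l⟩ ?_
    · linarith [(hxyθ k).1.1, Real.pi_pos]
    · linarith [(hxyθ l).1.1, Real.pi_pos]
    · refine (Real.strictAntiOn_cos.le_iff_ge ⟨(hxyθ l).1.1, ?_⟩ ⟨(hxyθ k).1.1, ?_⟩).mp ?_
      · linarith [hlt l, Real.pi_pos]
      · linarith [hlt k, Real.pi_pos]
      · rw [(hxyθ k).2, (hxyθ l).2]
        exact hxy.antitone_norm_inner hkl
  refine List.eq_filter_pos_append_replicate ?_ ?_ (posSingularValues_pairwise _) ?_ ?_ ?_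
  · rw [List.pairwise_reverse]
    exact hmono.sortedLE_ofFn.pairwise
  · simp only [List.mem_reverse, List.mem_ofFn]
    rintro _ ⟨k, rfl⟩
    exact Real.tan_nonneg_of_nonneg_of_le_pi_div_two (hxyθ k).1.1 (hxyθ k).1.2
  · intro a ha
    simpa using (List.mem_filter.mp ha).2
  · rw [List.length_reverse, List.length_ofFn, length_posSingularValues,
      hQR.rank_mul_pinv hqp hXY, hQR.finrank_inf hX hYr, hN]
  · rw [List.filter_reverse]
    refine (List.reverse_perm _).trans (Multiset.coe_eq_coe.mp ?_)
    -- Keeping positive entries discards the padding zeros coming from the `p`-dimensional domain of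
    -- `T`.
    have := congrArg (Multiset.filter fun a => 0 < a) hsv
    rw [Multiset.filter_add, Multiset.filter_eq_nil (s := Multiset.replicate _ _) |>.mpr
      (fun a ha => by rw [Multiset.eq_of_mem_replicate ha]; exact lt_irrefl _), add_zero,
      Fin.univ_val_map] at this
    exact this.symm
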